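/- Let $n$ be a natural number. A weighted $n$-tree is a finite tree whose leaves (vertices of degree one) are numbered by $[n]=\{1,\dots,n\}$ and whose edges have real lengths, where the edges not incident to a leaf have nonnegative length (edges incident to a leaf may have arbitrary real length; in particular all trees with nonnegative edge lengths are included). Let $D(i,j)$ be the sum of the lengths of the edges on the path between the leaves $i$ and $j$, and let $\mathcal{T}_n\subset\mathbb{R}^{\binom n2}$ be the set of dissimilarity vectors $(D(i,j))_{i<j}$ of weighted $n$-trees. Let $\phi^{(4)}:\mathbb{R}^{\binom n2}\to\mathbb{R}^{\binom n4}$ be the map sending $X=(X_{i,j})_{i<j}$ to the vector with entries, for $i<j<k<l$, $$X_{i,j,k,l}=\tfrac12\min\{X_{i,j}+X_{j,k}+X_{k,l}+X_{i,l},\; X_{i,j}+X_{j,l}+X_{k,l}+X_{i,k},\; X_{i,k}+X_{j,k}+X_{j,l}+X_{i,l}\}.$$ Let $K=\mathbb{C}\{\{t\}\}$ be the field of Puiseux series with its valuation $\mathrm{val}$ (the least exponent). Let $I_{4,n}\subset K[x_{ijkl}\mid 1\le i<j<k<l\le n]$ be the ideal of all polynomial relations between the $4\times4$ minors of a $4\times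 n$ matrix, and let the tropical Grassmannian $\mathcal{G}_{4,n}\subset\mathbb{R}^{\binom n4}$ be its tropical variety, i.e. the closure of the set of points $(-\mathrm{val}(x_{ijkl}))_{i<j<k<l}$, where $(x_{ijkl})$ runs over the points with nonzero coordinates in $K$ of the zero locus of $I_{4,n}$. Then $$\phi^{(4)}(\mathcal{T}_n)\subseteq\mathcal{G}_{4,n}\cap\phi^{(4)}(\mathbb{R}^{\binom n2}).$$ -/

import Mathlib

noncomputable section

/-! ### Puiseux series -/

/-- A Hahn series with exponents in `ℚ` whose exponents have a common denominator. -/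
def HasCommonDenominator (c : HahnSeries ℚ ℂ) : Prop :=
  ∃ N : ℕ, 0 < N ∧ ∀ q ∈ c.support, ∃ z : ℤ, q = (z : ℚ) / N

theorem strictMono_div_nat (N : ℕ) (hN : 0 < N) :
    StrictMono (fun z : ℤ => (z : ℚ) / N) := by
  intro a b hab
  have : (0 : ℚ) < N := by exact_mod_cast hN
  have h2 : (a : ℚ) < b := by exact_mod_cast hab
  show (a : ℚ) / N < (b : ℚ) / N
  gcongr

/-- The additive map `z ↦ z / N` from `ℤ` to `ℚ`. -/
def divNatHom (N : ℕ) : ℤ →+ ℚ where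
  toFun z := (z : ℚ) / N
  map_zero' := by simp
  map_add' a b := by push_cast; ring

theorem hasCommonDenominator_inv {c : HahnSeries ℚ ℂ} (hc : HasCommonDenominator c) :
    HasCommonDenominator c⁻¹ := by
  obtain ⟨N, hN, hs⟩ := hc
  have hm := strictMono_div_nat N hN
  let F : HahnSeries ℤ ℂ →+* HahnSeries ℚ ℂ :=
    HahnSeries.embDomainRingHom (divNatHom N) hm.injective (fun _ _ => hm.le_iff_le)
  have hF : ∀ (x : HahnSeries ℤ ℂ) (z : ℤ), (F x).coeff ((z : ℚ) / N) = x.coeff z := by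
    intro x z
    exact HahnSeries.embDomain_coeff (f := ⟨⟨divNatHom N, hm.injective⟩, hm.le_iff_le⟩)
  have hF0 : ∀ (x : HahnSeries ℤ ℂ) (q : ℚ), (¬ ∃ z : ℤ, q = (z : ℚ) / N) →
      (F x).coeff q = 0 := by
    intro x q hq
    refine HahnSeries.embDomain_of_notMem_range
      (f := ⟨⟨divNatHom N, hm.injective⟩, hm.le_iff_le⟩) ?_
    rintro ⟨z, hz⟩
    exact hq ⟨z, hz.symm⟩
  have hpwo : {z : ℤ | c.coeff ((z : ℚ) / N) ≠ 0}.IsPWO := by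
    apply Set.IsWF.isPWO
    have h := c.isWF_support
    rw [Set.isWF_iff_no_descending_seq] at h ⊢
    intro f hf hmem
    exact h (fun k => ((f k : ℤ) : ℚ) / N) (hm.comp_strictAnti hf) hmem
  let x : HahnSeries ℤ ℂ := ⟨fun z => c.coeff ((z : ℚ) / N), hpwo⟩
  have hx : F x = c := by
    ext q
    by_cases hq : ∃ z : ℤ, q = (z : ℚ) / N
    · obtain ⟨z, rfl⟩ := hq
      rw [hF]
    · rw [hF0 x q hq]
      by_contra h
      exact hq (hs q (fun h' => h h'.symm))
  refine ⟨N, hN, fun q hq => ?_⟩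
  by_contra hne
  apply hq
  rw [← hx, ← map_inv₀]
  exact hF0 _ q hne

/-- The field `ℂ{{t}}` of Puiseux series, as a subfield of the Hahn series with rational
exponents: the formal sums whose set of exponents is bounded below and has a common denominator.
(Given a common denominator, being bounded below is the same as being well-ordered.) -/
def puiseuxSubfield : Subfield (HahnSeries ℚ ℂ) where
  carrier := {c | HasCommonDenominator c}
  zero_mem' := ⟨1, one_pos, by simp⟩
  one_mem' := by
    refine ⟨1, one_pos, fun q hq => ⟨0, ?_⟩⟩
    rw [HahnSeries.support_one] at hq
    simpa using hq
  add_mem' := by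
    rintro a b ⟨N, hN, ha⟩ ⟨M, hM, hb⟩
    have hN' : (N : ℚ) ≠ 0 := by exact_mod_cast hN.ne'
    have hM' : (M : ℚ) ≠ 0 := by exact_mod_cast hM.ne'
    refine ⟨N * M, Nat.mul_pos hN hM, fun q hq => ?_⟩
    rcases HahnSeries.support_add_subset a b hq with h | h
    · obtain ⟨z, rfl⟩ := ha q h
      exact ⟨z * M, by push_cast; field_simp⟩
    · obtain ⟨z, rfl⟩ := hb q h
      exact ⟨z * N, by push_cast; field_simp⟩
  neg_mem' := by
    rintro a ⟨N, hN, ha⟩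
    exact ⟨N, hN, fun q hq => ha q (HahnSeries.support_neg_subset a hq)⟩
  mul_mem' := by
    rintro a b ⟨N, hN, ha⟩ ⟨M, hM, hb⟩
    have hN' : (N : ℚ) ≠ 0 := by exact_mod_cast hN.ne'
    have hM' : (M : ℚ) ≠ 0 := by exact_mod_cast hM.ne'
    refine ⟨N * M, Nat.mul_pos hN hM, fun q hq => ?_⟩
    obtain ⟨r, hr, s, hs, rfl⟩ := Set.mem_add.1 (HahnSeries.support_mul_subset hq)
    obtain ⟨z, rfl⟩ := ha r hr
    obtain ⟨w, rfl⟩ := hb s hs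
    exact ⟨z * M + w * N, by push_cast; field_simp⟩
  inv_mem' := fun _ hc => hasCommonDenominator_inv hc

/-- The field of Puiseux series over `ℂ`. -/
abbrev Puiseux : Type := puiseuxSubfield

/-- The valuation of a Puiseux series: its least exponent (only used for nonzero series). -/
def Puiseux.val (c : Puiseux) : ℚ := (c : HahnSeries ℚ ℂ).order

/-! ### Tropical varieties and tropical Grassmannians -/

/-- The tropical variety of an ideal `I` of the polynomial ring over the Puiseux series: the
closure in `ℝ^σ` of the set of points `(-val (x i))` for `x` in the zero locus of `I` with all
coordinates nonzero. -/
def tropicalVariety {σ : Type} (I : Ideal (MvPolynomial σ Puiseux)) : Set (σ → ℝ) :=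
  closure {w | ∃ x : σ → Puiseux, (∀ i, x i ≠ 0) ∧ (∀ f ∈ I, MvPolynomial.eval x f = 0) ∧
    ∀ i, w i = -((Puiseux.val (x i) : ℚ) : ℝ)}

/-- The ideal of all polynomial relations between the `m × m` minors of an `m × n` matrix of
indeterminates. The variables are indexed by the increasing sequences `i₁ < ⋯ < iₘ` in
`Fin n`. -/
def pluckerIdeal (m n : ℕ) : Ideal (MvPolynomial (Fin m ↪o Fin n) Puiseux) :=
  RingHom.ker (MvPolynomial.aeval (R := Puiseux) (fun e : Fin m ↪o Fin n =>
    ((Matrix.mvPolynomialX (Fin m) (Fin n) Puiseux).submatrix id e).det))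

/-- The tropical Grassmannian `G_{m,n}`. -/
def tropicalGrassmannian (m n : ℕ) : Set ((Fin m ↪o Fin n) → ℝ) :=
  tropicalVariety (pluckerIdeal m n)

/-! ### Weighted trees -/

/-- A leaf of a graph: a vertex of degree one. -/
def IsLeaf {V : Type} (G : SimpleGraph V) (v : V) : Prop := ∃! u, G.Adj v u

/-- A weighted `n`-tree: a finite tree whose leaves are numbered by `Fin n`, with real edge
lengths that are nonnegative on the interior edges (those not incident to a leaf). The values of
`length` off the edges of the tree play no role. -/
structure WeightedTree (n : ℕ) where
  V : Type
  finite : Finite V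
  graph : SimpleGraph V
  isTree : graph.IsTree
  leaf : Fin n ≃ {v : V // IsLeaf graph v}
  length : Sym2 V → ℝ
  length_nonneg : ∀ u v : V, graph.Adj u v → ¬ IsLeaf graph u → ¬ IsLeaf graph v →
    0 ≤ length s(u, v)

/-- The unique path between two vertices of the tree. -/
def WeightedTree.path {n : ℕ} (T : WeightedTree n) (u v : T.V) : T.graph.Walk u v :=
  (T.isTree.existsUnique_path u v).choose

/-- The distance between the leaves `i` and `j`: the sum of the lengths of the edges of the
path between them. -/
def WeightedTree.dist {n : ℕ} (T : WeightedTree n) (i j : Fin n) : ℝ :=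
  ((T.path (T.leaf i) (T.leaf j)).edges.map T.length).sum

/-- The pairs `i < j` in `Fin n`. -/
abbrev IncreasingPair (n : ℕ) : Type := {p : Fin n × Fin n // p.1 < p.2}

/-- The dissimilarity vector of an `n`-tree. -/
def WeightedTree.dissimilarityVector {n : ℕ} (T : WeightedTree n) : IncreasingPair n → ℝ :=
  fun p => T.dist p.1.1 p.1.2

/-- The set of dissimilarity vectors of weighted `n`-trees. -/
def treeSpace (n : ℕ) : Set (IncreasingPair n → ℝ) :=
  Set.range (WeightedTree.dissimilarityVector (n := n))

/-- The map `φ⁽⁴⁾ : ℝ^(n choose 2) → ℝ^(n choose 4)`: for `i < j < k < l` (the values of `e`), half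
the minimal total weight of the three cyclic tours through `i, j, k, l`. -/
def phi4 (n : ℕ) (X : IncreasingPair n → ℝ) : (Fin 4 ↪o Fin n) → ℝ := fun e =>
  let x : ∀ a b : Fin 4, a < b → ℝ := fun a b h => X ⟨(e a, e b), e.strictMono h⟩
  let ij := x 0 1 (by decide)
  let ik := x 0 2 (by decide)
  let il := x 0 3 (by decide)
  let jk := x 1 2 (by decide)
  let jl := x 1 3 (by decide)
  let kl := x 2 3 (by decide)
  min (ij + jk + kl + il) (min (ij + jl + kl + ik) (ik + jk + jl + il)) / 2

end

/-!
The theorem is proved by exhibiting, for each tree with rational edge lengths, a `4 × n` matrix of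
Puiseux series whose maximal minors have the required valuations.

Since the tropical Grassmannian is closed, the edge lengths may be taken rational
(`WeightedTree.phi4_mem`). Choose a leaf `r` as root. The paths from `r` to the leaves `i` and `j`
share an initial segment, and minus the length of this segment is an ultrametric `h i j`, because
the segments shared with a fixed path are nested and any difference between them consists of
interior edges, whose lengths are nonnegative; the root itself is put far from all other leaves.
Thus `D i j = 2 * h i j + s i + s j` with `h` ultrametric
(`WeightedTree.exists_ultrametric`). Leaf weights correspond to the scaling of
columns, so only `h` matters.

For an ultrametric `h` let `x i` and `y i` be the series whose coefficient at `t ^ (-q)` depends only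
on the ball of radius `q` around `i`. Then `-val (x i - x j) = h i j` and
`-val (y i - y j) ≤ h i j`, provided the coefficients of `x` tell the balls apart. Take the matrix
whose columns are `(1, x i, x i ^ 2, y i)`. Given four points, list them as `a, b, c, d` with
`h a b` minimal and `h b c ≤ h b d`. The shortest tour then has length
`h a b + h b c + h b d + h c d`. Grouping the determinant by differences
(`quadDet_eq_differences`) shows that `-val` of the minor is at most this number, and one of the
groups, `(y a - y b) * (x b - x c) * (x b - x d) * (x c - x d)`, can attain it. Whether the leading
terms cancel is decided by a linear functional of the coefficients of `y`. This functional is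
nonzero, as the coefficient of `y` at the ball of radius `h a b` around `a` enters no other group
(`IsSortedQuad.exists_coeff_ne_zero`), so some choice of `y` avoids cancellation for all quadruples
(`exists_orderTop_quadDet`).
-/

noncomputable section

/-! ### Ultrametrics and tours -/

/-- A symmetric function that satisfies the ultrametric inequality on triples of distinct points.
Its values may be negative and its values on the diagonal are irrelevant. -/
structure IsOffDiagUltrametric {ι : Type} (h : ι → ι → ℚ) : Prop where
  symm : ∀ i j, h i j = h j i
  le_max : ∀ i j k, i ≠ j → j ≠ k → i ≠ k → h i k ≤ max (h i j) (h j k)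

section SortedQuad

variable {ι : Type}

/-- The length of the shortest cyclic tour through four points. -/
def minTour {R : Type} [Field R] [LinearOrder R] (h : ι → ι → R) (a b c d : ι) : R :=
  min (h a b + h b c + h c d + h a d)
    (min (h a b + h b d + h c d + h a c) (h a c + h b c + h b d + h a d))

/-- Four points listed so that the first two are closest to each other, and the third is at
least as close to them as the fourth. -/
structure IsSortedQuad (h : ι → ι → ℚ) (a b c d : ι) : Prop where
  ac : h a b ≤ h a c
  ad : h a b ≤ h a d
  bc : h a b ≤ h b c
  bd : h a b ≤ h b d
  cd : h a b ≤ h c d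
  le : h b c ≤ h b d

/-- Every property of quadruples of distinct points that is invariant under permutations can be
verified on sorted quadruples. -/
theorem quadruple_induction {h : ι → ι → ℚ} (hsymm : ∀ i j, h i j = h j i)
    {Q : ι → ι → ι → ι → Prop} (hab : ∀ a b c d, Q a b c d → Q b a c d)
    (hbc : ∀ a b c d, Q a b c d → Q a c b d) (hcd : ∀ a b c d, Q a b c d → Q a b d c)
    (hQ : ∀ a b c d, a ≠ b → a ≠ c → a ≠ d → b ≠ c → b ≠ d → c ≠ d →
      IsSortedQuad h a b c d → Q a b c d)
    (a b c d : ι) (nab : a ≠ b) (nac : a ≠ c) (nad : a ≠ d) (nbc : b ≠ c) (nbd : b ≠ d)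
    (ncd : c ≠ d) : Q a b c d := by
  have key : ∀ a b c d, a ≠ b → a ≠ c → a ≠ d → b ≠ c → b ≠ d → c ≠ d →
      h a b ≤ h a c → h a b ≤ h a d → h a b ≤ h b c → h a b ≤ h b d → h a b ≤ h c d →
      Q a b c d := by
    intro a b c d n1 n2 n3 n4 n5 n6 h1 h2 h3 h4 h5
    rcases le_total (h b c) (h b d) with hle | hle
    · exact hQ a b c d n1 n2 n3 n4 n5 n6 ⟨h1, h2, h3, h4, h5, hle⟩
    · exact hcd _ _ _ _ (hQ a b d c n1 n3 n2 n5 n4 n6.symm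
        ⟨h2, h1, h4, h3, hsymm c d ▸ h5, hle⟩)
  obtain ⟨m, hm, hle⟩ := Finset.exists_min_image
    ({h a b, h a c, h a d, h b c, h b d, h c d} : Finset ℚ) id ⟨h a b, by simp⟩
  simp only [Finset.mem_insert, Finset.mem_singleton, id, forall_eq_or_imp, forall_eq] at hm hle
  obtain ⟨h1, h2, h3, h4, h5, h6⟩ := hle
  rcases hm with rfl | rfl | rfl | rfl | rfl | rfl
  · exact key a b c d nab nac nad nbc nbd ncd h2 h3 h4 h5 h6
  · exact hbc _ _ _ _ (key a c b d nac nab nad nbc.symm ncd nbd h1 h3 (hsymm c b ▸ h4) h6 h5)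
  · exact hcd _ _ _ _ (hbc _ _ _ _ (key a d b c nad nab nac nbd.symm ncd.symm nbc h1 h2
      (hsymm d b ▸ h5) (hsymm d c ▸ h6) h4))
  · exact hab _ _ _ _ (hbc _ _ _ _ (key b c a d nbc nab.symm nbd nac.symm ncd nad
      (hsymm b a ▸ h1) h5 (hsymm c a ▸ h2) h6 h3))
  · exact hcd _ _ _ _ (hab _ _ _ _ (hbc _ _ _ _ (key b d a c nbd nab.symm nbc nad.symm ncd.symm
      nac (hsymm b a ▸ h1) h4 (hsymm d a ▸ h3) (hsymm d c ▸ h6) h2)))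
  · exact hbc _ _ _ _ (hab _ _ _ _ (hcd _ _ _ _ (hbc _ _ _ _ (key c d a b ncd nac.symm nbc.symm
      nad.symm nbd.symm nab (hsymm c a ▸ h2) (hsymm c b ▸ h4) (hsymm d a ▸ h3) (hsymm d b ▸ h5)
      h1))))

theorem IsSortedQuad.eqs {h : ι → ι → ℚ} (hh : IsOffDiagUltrametric h) {a b c d : ι}
    (nab : a ≠ b) (nac : a ≠ c) (nad : a ≠ d) (nbc : b ≠ c) (nbd : b ≠ d) (ncd : c ≠ d)
    (hs : IsSortedQuad h a b c d) : h a c = h b c ∧ h a d = h b d ∧ h c d ≤ h b d := by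
  have e1 := hh.le_max a b c nab nbc nac
  have e2 := hh.le_max b a c nab.symm nac nbc
  have e3 := hh.le_max a b d nab nbd nad
  have e4 := hh.le_max b a d nab.symm nad nbd
  have e5 := hh.le_max c b d nbc.symm nbd ncd
  rw [hh.symm b a] at e2 e4
  rw [hh.symm c b] at e5
  rw [max_eq_right hs.bc] at e1
  rw [max_eq_right hs.ac] at e2
  rw [max_eq_right hs.bd] at e3
  rw [max_eq_right hs.ad] at e4
  rw [max_eq_right hs.le] at e5
  exact ⟨le_antisymm e1 e2, le_antisymm e3 e4, e5⟩

/-- On a sorted quadruple the first two tours are shortest. -/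
theorem IsSortedQuad.minTour_eq {h : ι → ι → ℚ} (hh : IsOffDiagUltrametric h) {a b c d : ι}
    (nab : a ≠ b) (nac : a ≠ c) (nad : a ≠ d) (nbc : b ≠ c) (nbd : b ≠ d) (ncd : c ≠ d)
    (hs : IsSortedQuad h a b c d) :
    minTour h a b c d = h a b + h b c + h b d + h c d := by
  obtain ⟨e1, e2, e3⟩ := hs.eqs hh nab nac nad nbc nbd ncd
  have := hs.bc
  unfold minTour
  rw [min_eq_left (le_min (by linarith) (by linarith))]
  linarith

end SortedQuad

/-! ### Series attached to an ultrametric -/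

section BallSeries

variable {ι : Type} [Fintype ι]

/-- The finite set of values of `h`. -/
def valueSet (h : ι → ι → ℚ) : Finset ℚ := Finset.univ.image fun p : ι × ι => h p.1 p.2

theorem mem_valueSet (h : ι → ι → ℚ) (i j : ι) : h i j ∈ valueSet h :=
  Finset.mem_image.2 ⟨(i, j), Finset.mem_univ _, rfl⟩

/-- Numbers separating the balls: any injection of the finite sets into `ℕ` will do. -/
def ballCode (p : ℚ × Finset ι) : ℂ := ((Fintype.equivFin (Finset ι) p.2 : ℕ) : ℂ)

theorem ballCode_injective (q : ℚ) : Function.Injective fun s : Finset ι => ballCode (q, s) := by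
  intro s t hst
  simpa [ballCode, Fin.val_inj] using hst

variable [DecidableEq ι]

/-- The open ball of radius `q` around `i`; the diagonal values of `h` are not used. -/
def openBall (h : ι → ι → ℚ) (q : ℚ) (i : ι) : Finset ι :=
  Finset.univ.filter fun j => j = i ∨ h j i < q

theorem openBall_eq {h : ι → ι → ℚ} (hh : IsOffDiagUltrametric h) {q : ℚ} {i j : ι}
    (hij : i ≠ j) (hq : h i j < q) : openBall h q i = openBall h q j := by
  have key : ∀ i j, i ≠ j → h i j < q → openBall h q i ⊆ openBall h q j := by
    intro i j hij hq k hk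
    simp only [openBall, Finset.mem_filter, Finset.mem_univ, true_and] at hk ⊢
    rcases hk with rfl | hk
    · exact Or.inr hq
    · by_cases hkj : k = j
      · exact Or.inl hkj
      · by_cases hki : k = i
        · subst hki; exact Or.inr hq
        · exact Or.inr ((hh.le_max k i j hki hij hkj).trans_lt (max_lt hk hq))
  exact (key i j hij hq).antisymm (key j i hij.symm (hh.symm i j ▸ hq))

theorem openBall_ne {h : ι → ι → ℚ} {q : ℚ} {i j : ι}
    (hij : i ≠ j) (hq : q ≤ h i j) : openBall h q i ≠ openBall h q j := by
  intro he
  have hi : i ∈ openBall h q i := by simp [openBall]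
  rw [he] at hi
  simp only [openBall, Finset.mem_filter, Finset.mem_univ, true_and] at hi
  rcases hi with hi | hi
  · exact hij hi
  · exact absurd hi (not_lt.2 hq)

/-- The series whose coefficient at `t ^ (-q)`, for `q` a value of `h`, is the number that `c`
assigns to the ball of radius `q` around `i`. Two points share the coefficients of all radii
greater than their distance. -/
def ballSeries (h : ι → ι → ℚ) (c : ℚ × Finset ι → ℂ) (i : ι) : HahnSeries ℚ ℂ :=
  ∑ q ∈ valueSet h, HahnSeries.single (-q) (c (q, openBall h q i))

theorem coeff_ballSeries (h : ι → ι → ℚ) (c : ℚ × Finset ι → ℂ) (i : ι) (q : ℚ) :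
    (ballSeries h c i).coeff (-q) = if q ∈ valueSet h then c (q, openBall h q i) else 0 := by
  simp only [ballSeries, HahnSeries.coeff_sum, HahnSeries.coeff_single, neg_inj]
  rw [Finset.sum_ite_eq]

theorem le_orderTop_ballSeries_sub {h : ι → ι → ℚ} (hh : IsOffDiagUltrametric h)
    (c : ℚ × Finset ι → ℂ) {i j : ι} (hij : i ≠ j) :
    ((-h i j : ℚ) : WithTop ℚ) ≤ (ballSeries h c i - ballSeries h c j).orderTop := by
  rw [HahnSeries.le_orderTop_iff_forall]
  intro p hp
  have hp' : h i j < -p := by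
    have := WithTop.coe_lt_coe.1 hp
    linarith
  rw [HahnSeries.coeff_sub, ← neg_neg p, coeff_ballSeries, coeff_ballSeries,
    openBall_eq hh hij hp', sub_self]

theorem orderTop_eq_of_coeff_ne_zero {x : HahnSeries ℚ ℂ} {p : ℚ}
    (hx : (p : WithTop ℚ) ≤ x.orderTop) (hc : x.coeff p ≠ 0) : x.orderTop = p :=
  le_antisymm (HahnSeries.orderTop_le_of_coeff_ne_zero hc) hx

theorem orderTop_ballSeries_sub {h : ι → ι → ℚ} (hh : IsOffDiagUltrametric h)
    {c : ℚ × Finset ι → ℂ} (hc : ∀ q, Function.Injective fun s => c (q, s)) {i j : ι}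
    (hij : i ≠ j) :
    (ballSeries h c i - ballSeries h c j).orderTop = ((-h i j : ℚ) : WithTop ℚ) := by
  refine orderTop_eq_of_coeff_ne_zero (le_orderTop_ballSeries_sub hh c hij) ?_
  rw [HahnSeries.coeff_sub, coeff_ballSeries, coeff_ballSeries, if_pos (mem_valueSet h i j),
    if_pos (mem_valueSet h i j), sub_ne_zero]
  exact fun he => openBall_ne hij le_rfl (hc _ he)

/-! ### The determinant of the rows `1, x, x ^ 2, y` -/

/-- The Vandermonde determinant of three numbers. -/
def vandermondeThree {R : Type} [CommRing R] (a b c : R) : R := (b - a) * (c - a) * (c - b)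

/-- The determinant with rows `1, x, x ^ 2, y` and columns `a, b, c, d`, expanded along the last
row. -/
def quadDet {R : Type} [CommRing R] {ι : Type} (x y : ι → R) (a b c d : ι) : R :=
  y d * vandermondeThree (x a) (x b) (x c) - y c * vandermondeThree (x a) (x b) (x d)
    + y b * vandermondeThree (x a) (x c) (x d) - y a * vandermondeThree (x b) (x c) (x d)

theorem det_eq_quadDet {R : Type} [CommRing R] {ι : Type} (z x y : ι → R) (e : Fin 4 → ι) :
    Matrix.det (Matrix.of ![fun j => z (e j), fun j => z (e j) * x (e j),
      fun j => z (e j) * x (e j) ^ 2, fun j => z (e j) * y (e j)]) =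
    z (e 0) * z (e 1) * z (e 2) * z (e 3) * quadDet x y (e 0) (e 1) (e 2) (e 3) := by
  simp only [Matrix.det_succ_row_zero, Fin.sum_univ_succ, quadDet, vandermondeThree]
  simp [Fin.succAbove]
  ring

theorem le_orderTop_mul {x y : HahnSeries ℚ ℂ} {p q : ℚ} (hx : (p : WithTop ℚ) ≤ x.orderTop)
    (hy : (q : WithTop ℚ) ≤ y.orderTop) : ((p + q : ℚ) : WithTop ℚ) ≤ (x * y).orderTop := by
  rw [HahnSeries.orderTop_mul, WithTop.coe_add]
  exact add_le_add hx hy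

theorem le_orderTop_add {x y : HahnSeries ℚ ℂ} {p : WithTop ℚ} (hx : p ≤ x.orderTop)
    (hy : p ≤ y.orderTop) : p ≤ (x + y).orderTop :=
  (le_min hx hy).trans HahnSeries.min_orderTop_le_orderTop_add

/-- Grouping the expansion of the determinant by differences of `x` and `y`. -/
theorem quadDet_eq_differences {R : Type} [CommRing R] {ι : Type} (x y : ι → R) (a b c d : ι) :
    quadDet x y a b c d =
      (y a - y b) * (x b - x c) * (x b - x d) * (x c - x d)
      + (y b - y c) * (x c - x d) * (x a - x b) * ((x c - x b) + (x d - x a))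
      + (y c - y d) * (x a - x b) * (x a - x c) * (x b - x c) := by
  simp only [quadDet, vandermondeThree]; ring

/-- The entries `x i` of the matrix with rows `1, x, x ^ 2, y`: series with
`-val (x i - x j) = h i j`. -/
def xSeries (h : ι → ι → ℚ) : ι → HahnSeries ℚ ℂ := ballSeries h ballCode

theorem orderTop_xSeries_sub {h : ι → ι → ℚ} (hh : IsOffDiagUltrametric h) {i j : ι}
    (hij : i ≠ j) : (xSeries h i - xSeries h j).orderTop = ((-h i j : ℚ) : WithTop ℚ) :=
  orderTop_ballSeries_sub hh ballCode_injective hij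

theorem IsSortedQuad.le_orderTop_quadDet {h : ι → ι → ℚ} (hh : IsOffDiagUltrametric h)
    {a b c d : ι} (nab : a ≠ b) (nac : a ≠ c) (nad : a ≠ d) (nbc : b ≠ c) (nbd : b ≠ d)
    (ncd : c ≠ d) (hs : IsSortedQuad h a b c d) (f : ℚ × Finset ι → ℂ) :
    ((-minTour h a b c d : ℚ) : WithTop ℚ) ≤
      (quadDet (xSeries h) (ballSeries h f) a b c d).orderTop := by
  obtain ⟨e1, e2, e3⟩ := hs.eqs hh nab nac nad nbc nbd ncd
  have hle := hs.le
  have h1 := hs.bc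
  rw [hs.minTour_eq hh nab nac nad nbc nbd ncd, quadDet_eq_differences]
  have hx : ∀ {i j}, i ≠ j →
      ((-h i j : ℚ) : WithTop ℚ) ≤ (xSeries h i - xSeries h j).orderTop :=
    fun hij => (orderTop_xSeries_sub hh hij).ge
  have hy : ∀ {i j}, i ≠ j →
      ((-h i j : ℚ) : WithTop ℚ) ≤ (ballSeries h f i - ballSeries h f j).orderTop :=
    fun hij => le_orderTop_ballSeries_sub hh f hij
  have hmid : ((-h b d : ℚ) : WithTop ℚ) ≤
      ((xSeries h c - xSeries h b) + (xSeries h d - xSeries h a)).orderTop := by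
    refine le_orderTop_add ((WithTop.coe_le_coe.2 ?_).trans (hx nbc.symm))
      ((WithTop.coe_le_coe.2 ?_).trans (hx nad.symm))
    · rw [hh.symm c b]; linarith
    · rw [hh.symm d a]; linarith
  refine le_orderTop_add (le_orderTop_add ?_ ?_) ?_
  · refine (WithTop.coe_le_coe.2 ?_).trans (le_orderTop_mul (le_orderTop_mul
      (le_orderTop_mul (hy nab) (hx nbc)) (hx nbd)) (hx ncd))
    linarith
  · refine (WithTop.coe_le_coe.2 ?_).trans (le_orderTop_mul (le_orderTop_mul
      (le_orderTop_mul (hy nbc) (hx ncd)) (hx nab)) hmid)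
    linarith
  · refine (WithTop.coe_le_coe.2 ?_).trans (le_orderTop_mul (le_orderTop_mul
      (le_orderTop_mul (hy ncd) (hx nab)) (hx nac)) (hx nbc))
    linarith

/-- Taking for `y` the single term of `a` at the radius `h a b`, which none of the other three
points sees, leaves one Vandermonde determinant of the expansion. -/
theorem IsSortedQuad.exists_coeff_ne_zero {h : ι → ι → ℚ} (hh : IsOffDiagUltrametric h)
    {a b c d : ι} (nab : a ≠ b) (nac : a ≠ c) (nad : a ≠ d) (nbc : b ≠ c) (nbd : b ≠ d)
    (ncd : c ≠ d) (hs : IsSortedQuad h a b c d) :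
    ∃ f : ℚ × Finset ι → ℂ,
      (quadDet (xSeries h) (ballSeries h f) a b c d).coeff (-minTour h a b c d) ≠ 0 := by
  set f : ℚ × Finset ι → ℂ := Pi.single (h a b, openBall h (h a b) a) 1 with hf
  have hy0 : ∀ j, a ≠ j → h a b ≤ h a j → ballSeries h f j = 0 := by
    intro j hj hle
    ext q
    rw [← neg_neg q, coeff_ballSeries, hf]
    have : ¬ ((-q, openBall h (-q) j) = (h a b, openBall h (h a b) a)) := by
      intro he
      rw [Prod.mk.injEq] at he
      rw [he.1] at he
      exact openBall_ne hj hle he.2.symm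
    simp [this]
  have hya : ballSeries h f a = HahnSeries.single (-h a b) 1 := by
    ext q
    rw [← neg_neg q, coeff_ballSeries, HahnSeries.coeff_single, hf]
    by_cases hq : -q = h a b
    · simp [hq, mem_valueSet]
    · have hq' : q ≠ -h a b := fun he => hq (by rw [he, neg_neg])
      simp [hq, hq']
  refine ⟨f, HahnSeries.coeff_orderTop_ne ?_⟩
  rw [hs.minTour_eq hh nab nac nad nbc nbd ncd, quadDet_eq_differences, hya,
    hy0 b nab le_rfl, hy0 c nac hs.ac, hy0 d nad hs.ad]
  simp only [sub_zero, zero_mul, add_zero, HahnSeries.orderTop_mul,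
    orderTop_xSeries_sub hh nbc, orderTop_xSeries_sub hh nbd, orderTop_xSeries_sub hh ncd,
    HahnSeries.orderTop_single (one_ne_zero (α := ℂ)), ← WithTop.coe_add]
  congr 1; ring

theorem quadDet_bound_and_coeff {h : ι → ι → ℚ} (hh : IsOffDiagUltrametric h)
    (a b c d : ι) (nab : a ≠ b) (nac : a ≠ c) (nad : a ≠ d) (nbc : b ≠ c) (nbd : b ≠ d)
    (ncd : c ≠ d) :
    (∀ f : ℚ × Finset ι → ℂ, ((-minTour h a b c d : ℚ) : WithTop ℚ) ≤
      (quadDet (xSeries h) (ballSeries h f) a b c d).orderTop) ∧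
    ∃ f : ℚ × Finset ι → ℂ,
      (quadDet (xSeries h) (ballSeries h f) a b c d).coeff (-minTour h a b c d) ≠ 0 := by
  -- A transposition changes the sign of the determinant and preserves the shortest tour.
  have swap : ∀ {a b c d a' b' c' d' : ι}, minTour h a b c d = minTour h a' b' c' d' →
      (∀ y : ι → HahnSeries ℚ ℂ,
        quadDet (xSeries h) y a' b' c' d' = -quadDet (xSeries h) y a b c d) →
      ((∀ f : ℚ × Finset ι → ℂ, ((-minTour h a b c d : ℚ) : WithTop ℚ) ≤
        (quadDet (xSeries h) (ballSeries h f) a b c d).orderTop) ∧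
      ∃ f : ℚ × Finset ι → ℂ,
        (quadDet (xSeries h) (ballSeries h f) a b c d).coeff (-minTour h a b c d) ≠ 0) →
      ((∀ f : ℚ × Finset ι → ℂ, ((-minTour h a' b' c' d' : ℚ) : WithTop ℚ) ≤
        (quadDet (xSeries h) (ballSeries h f) a' b' c' d').orderTop) ∧
      ∃ f : ℚ × Finset ι → ℂ,
        (quadDet (xSeries h) (ballSeries h f) a' b' c' d').coeff
          (-minTour h a' b' c' d') ≠ 0) := by
    intro a b c d a' b' c' d' hm hq hP
    simpa only [← hm, hq, HahnSeries.orderTop_neg, HahnSeries.coeff_neg, neg_ne_zero] using hP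
  refine quadruple_induction (Q := fun a b c d =>
      (∀ f : ℚ × Finset ι → ℂ, ((-minTour h a b c d : ℚ) : WithTop ℚ) ≤
        (quadDet (xSeries h) (ballSeries h f) a b c d).orderTop) ∧
      ∃ f : ℚ × Finset ι → ℂ,
        (quadDet (xSeries h) (ballSeries h f) a b c d).coeff (-minTour h a b c d) ≠ 0)
    hh.symm ?_ ?_ ?_ ?_ a b c d nab nac nad nbc nbd ncd
  · intro a b c d
    refine swap ?_ fun y => by simp only [quadDet, vandermondeThree]; ring
    rw [minTour, minTour, hh.symm b a, min_left_comm]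
    exact congrArg₂ min (by ring) (congrArg₂ min (by ring) (by ring))
  · intro a b c d
    refine swap ?_ fun y => by simp only [quadDet, vandermondeThree]; ring
    rw [minTour, minTour, hh.symm c b]
    exact (min_comm _ _).trans ((min_assoc _ _ _).trans ((min_left_comm _ _ _).trans
      (congrArg₂ min (by ring) (congrArg₂ min (by ring) (by ring)))))
  · intro a b c d
    refine swap ?_ fun y => by simp only [quadDet, vandermondeThree]; ring
    rw [minTour, minTour, hh.symm d c, min_left_comm]
    exact congrArg₂ min (by ring) (congrArg₂ min (by ring) (by ring))
  · intro a b c d nab nac nad nbc nbd ncd hs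
    exact ⟨hs.le_orderTop_quadDet hh nab nac nad nbc nbd ncd,
      hs.exists_coeff_ne_zero hh nab nac nad nbc nbd ncd⟩

theorem ballSeries_add (h : ι → ι → ℚ) (f g : ℚ × Finset ι → ℂ) (i : ι) :
    ballSeries h (f + g) i = ballSeries h f i + ballSeries h g i := by
  simp [ballSeries, Finset.sum_add_distrib]

theorem ballSeries_smul (h : ι → ι → ℚ) (r : ℂ) (f : ℚ × Finset ι → ℂ) (i : ι) :
    ballSeries h (r • f) i = HahnSeries.C r * ballSeries h f i := by
  rw [HahnSeries.C_mul_eq_smul]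
  ext q
  rw [HahnSeries.coeff_smul, ← neg_neg q, coeff_ballSeries, coeff_ballSeries]
  split_ifs <;> simp

/-- A coefficient of the determinant as a linear functional of the coefficients of `y`. -/
def quadDetCoeff (h : ι → ι → ℚ) (x : ι → HahnSeries ℚ ℂ) (a b c d : ι) (q : ℚ) :
    Module.Dual ℂ (ℚ × Finset ι → ℂ) where
  toFun f := (quadDet x (ballSeries h f) a b c d).coeff q
  map_add' f g := by
    rw [← HahnSeries.coeff_add]
    congr 1
    simp only [quadDet, ballSeries_add]
    ring
  map_smul' r f := by
    rw [RingHom.id_apply, ← HahnSeries.coeff_smul, ← HahnSeries.C_mul_eq_smul]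
    congr 1
    simp only [quadDet, ballSeries_smul]
    ring

/-- Generic coefficients of `y` avoid the cancellation of the leading terms for all quadruples
simultaneously. -/
theorem exists_orderTop_quadDet {h : ι → ι → ℚ} (hh : IsOffDiagUltrametric h) :
    ∃ f : ℚ × Finset ι → ℂ, ∀ e : Fin 4 ↪ ι,
      (quadDet (xSeries h) (ballSeries h f) (e 0) (e 1) (e 2) (e 3)).orderTop =
        ((-minTour h (e 0) (e 1) (e 2) (e 3) : ℚ) : WithTop ℚ) := by
  have key := fun e : Fin 4 ↪ ι => quadDet_bound_and_coeff hh (e 0) (e 1) (e 2) (e 3)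
    (e.injective.ne (by decide)) (e.injective.ne (by decide)) (e.injective.ne (by decide))
    (e.injective.ne (by decide)) (e.injective.ne (by decide)) (e.injective.ne (by decide))
  obtain ⟨f, hf⟩ := Module.Dual.exists_forall_ne_zero_of_forall_exists
    (fun e : Fin 4 ↪ ι => quadDetCoeff h (xSeries h) (e 0) (e 1) (e 2) (e 3)
      (-minTour h (e 0) (e 1) (e 2) (e 3))) fun e => (key e).2
  exact ⟨f, fun e => orderTop_eq_of_coeff_ne_zero ((key e).1 f) (hf e)⟩

/-! ### Points of the tropical Grassmannian -/

theorem single_mem_puiseuxSubfield (q : ℚ) (c : ℂ) :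
    HahnSeries.single q c ∈ puiseuxSubfield := by
  refine ⟨q.den, q.den_pos, fun p hp => ⟨q.num, ?_⟩⟩
  rw [Set.mem_singleton_iff.1 (HahnSeries.support_single_subset hp), Rat.num_div_den]

theorem ballSeries_mem_puiseuxSubfield (h : ι → ι → ℚ) (f : ℚ × Finset ι → ℂ) (i : ι) :
    ballSeries h f i ∈ puiseuxSubfield :=
  sum_mem fun _ _ => single_mem_puiseuxSubfield _ _

end BallSeries

/-- The vector of maximal minors of a matrix over the Puiseux series lies on the Grassmannian. -/
theorem eval_minors_eq_zero {m n : ℕ} (M : Matrix (Fin m) (Fin n) Puiseux)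
    {F : MvPolynomial (Fin m ↪o Fin n) Puiseux} (hF : F ∈ pluckerIdeal m n) :
    MvPolynomial.eval (fun e : Fin m ↪o Fin n => (M.submatrix id e).det) F = 0 := by
  have h0 := (RingHom.mem_ker).1 hF
  have h1 := congrArg (MvPolynomial.eval fun p : Fin m × Fin n => M p.1 p.2) h0
  rw [map_zero] at h1
  rw [← h1, MvPolynomial.aeval_def, MvPolynomial.eval₂_eq', map_sum, MvPolynomial.eval_eq']
  refine Finset.sum_congr rfl fun d _ => ?_
  rw [map_mul, map_prod]
  congr 1
  · simp [MvPolynomial.algebraMap_eq]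
  · refine Finset.prod_congr rfl fun e _ => ?_
    rw [map_pow, RingHom.map_det]
    congr 2
    ext i j
    simp [Matrix.mvPolynomialX]

theorem neg_val_minors_mem_tropicalGrassmannian {m n : ℕ} (M : Matrix (Fin m) (Fin n) Puiseux)
    {w : (Fin m ↪o Fin n) → ℝ} (hM : ∀ e : Fin m ↪o Fin n, (M.submatrix id e).det ≠ 0)
    (hw : ∀ e, w e = -((Puiseux.val (M.submatrix id e).det : ℚ) : ℝ)) :
    w ∈ tropicalGrassmannian m n :=
  subset_closure ⟨_, hM, fun _ hF => eval_minors_eq_zero M hF, hw⟩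

theorem coe_quadDet {ι : Type} (x y : ι → Puiseux) (a b c d : ι) :
    ((quadDet x y a b c d : Puiseux) : HahnSeries ℚ ℂ) =
      quadDet (fun i => (x i : HahnSeries ℚ ℂ)) (fun i => (y i : HahnSeries ℚ ℂ)) a b c d := by
  simp [quadDet, vandermondeThree]

/-- The tours of an ultrametric, shifted by the leaf weights `s`, form a point of the tropical
Grassmannian: scale the column of `i` in the matrix with rows `1, x, x ^ 2, y` by
`t ^ (-s i)`. -/
theorem minTour_add_mem_tropicalGrassmannian {n : ℕ} {h : Fin n → Fin n → ℚ}
    (hh : IsOffDiagUltrametric h) (s : Fin n → ℚ) :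
    (fun e : Fin 4 ↪o Fin n => ((minTour h (e 0) (e 1) (e 2) (e 3)
      + (s (e 0) + s (e 1) + s (e 2) + s (e 3)) : ℚ) : ℝ)) ∈ tropicalGrassmannian 4 n := by
  obtain ⟨f, hf⟩ := exists_orderTop_quadDet hh
  let x : Fin n → Puiseux := fun i => ⟨xSeries h i, ballSeries_mem_puiseuxSubfield h _ i⟩
  let y : Fin n → Puiseux := fun i => ⟨ballSeries h f i, ballSeries_mem_puiseuxSubfield h f i⟩
  let z : Fin n → Puiseux := fun i => ⟨HahnSeries.single (-s i) 1, single_mem_puiseuxSubfield _ _⟩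
  let M : Matrix (Fin 4) (Fin n) Puiseux :=
    Matrix.of ![fun j => z j, fun j => z j * x j, fun j => z j * x j ^ 2, fun j => z j * y j]
  have hdet : ∀ e : Fin 4 ↪o Fin n, (M.submatrix id e).det =
      z (e 0) * z (e 1) * z (e 2) * z (e 3) * quadDet x y (e 0) (e 1) (e 2) (e 3) := by
    intro e
    rw [← det_eq_quadDet z x y e]
    congr 1
    ext i j
    fin_cases i <;> rfl
  have hord : ∀ e : Fin 4 ↪o Fin n,
      ((M.submatrix id e).det : HahnSeries ℚ ℂ).orderTop =
        ((-(minTour h (e 0) (e 1) (e 2) (e 3)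
          + (s (e 0) + s (e 1) + s (e 2) + s (e 3))) : ℚ) : WithTop ℚ) := by
    intro e
    have hz : ∀ i, (z i : HahnSeries ℚ ℂ).orderTop = ((-s i : ℚ) : WithTop ℚ) :=
      fun i => HahnSeries.orderTop_single one_ne_zero
    have hq : ((quadDet x y (e 0) (e 1) (e 2) (e 3) : Puiseux) : HahnSeries ℚ ℂ).orderTop =
        ((-minTour h (e 0) (e 1) (e 2) (e 3) : ℚ) : WithTop ℚ) := by
      rw [coe_quadDet]
      exact hf e.toEmbedding
    rw [hdet]
    simp only [Subfield.coe_mul, HahnSeries.orderTop_mul, hz, hq, ← WithTop.coe_add]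
    congr 1; ring
  have hne : ∀ e : Fin 4 ↪o Fin n, (M.submatrix id e).det ≠ 0 := by
    intro e he
    have := hord e
    rw [he, ZeroMemClass.coe_zero, HahnSeries.orderTop_zero] at this
    exact WithTop.top_ne_coe this
  refine neg_val_minors_mem_tropicalGrassmannian M hne fun e => ?_
  have hne' : ((M.submatrix id e).det : HahnSeries ℚ ℂ) ≠ 0 := fun he => hne e (Subtype.ext he)
  have : Puiseux.val (M.submatrix id e).det = -(minTour h (e 0) (e 1) (e 2) (e 3)
          + (s (e 0) + s (e 1) + s (e 2) + s (e 3))) := by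
    have h2 := HahnSeries.order_eq_orderTop_of_ne_zero hne'
    rw [hord e] at h2
    exact WithTop.coe_injective h2
  rw [this]
  push_cast
  ring

/-! ### Paths from a root of a tree -/

section RootedTree

open SimpleGraph

variable {V : Type} {G : SimpleGraph V}

/-- The path between two vertices of a tree. -/
def treePath (hG : G.IsTree) (u v : V) : G.Walk u v := (hG.existsUnique_path u v).choose

theorem isPath_treePath (hG : G.IsTree) (u v : V) : (treePath hG u v).IsPath :=
  (hG.existsUnique_path u v).choose_spec.1

theorem eq_treePath (hG : G.IsTree) {u v : V} {p : G.Walk u v} (hp : p.IsPath) :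
    p = treePath hG u v :=
  (hG.existsUnique_path u v).choose_spec.2 p hp

open Classical in
/-- The edges of the path from the root `r` to the vertex `v`. -/
def rootEdges (hG : G.IsTree) (r v : V) : Finset (Sym2 V) := (treePath hG r v).edges.toFinset

theorem mem_rootEdges {hG : G.IsTree} {r v : V} {e : Sym2 V} :
    e ∈ rootEdges hG r v ↔ e ∈ (treePath hG r v).edges := by
  classical
  simp [rootEdges]

theorem rootEdges_self (hG : G.IsTree) (r : V) : rootEdges hG r r = ∅ := by
  classical
  rw [rootEdges, ← eq_treePath hG (Walk.IsPath.nil (u := r))]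
  simp

/-- Of two adjacent vertices one is the parent of the other. -/
theorem rootEdges_of_adj (hG : G.IsTree) (r : V) {u v : V} (huv : G.Adj u v) :
    (s(u, v) ∉ rootEdges hG r u ∧ ∀ e, e ∈ rootEdges hG r v ↔ e = s(u, v) ∨ e ∈ rootEdges hG r u) ∨
    (s(u, v) ∉ rootEdges hG r v ∧
      ∀ e, e ∈ rootEdges hG r u ↔ e = s(u, v) ∨ e ∈ rootEdges hG r v) := by
  have key : ∀ {u v : V}, G.Adj u v → u ∈ (treePath hG r v).support →
      (s(u, v) ∉ rootEdges hG r u ∧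
        ∀ e, e ∈ rootEdges hG r v ↔ e = s(u, v) ∨ e ∈ rootEdges hG r u) := by
    intro u v huv hu
    have hv := hG.isAcyclic.ne_mem_support_of_support_of_adj_of_isPath
      (isPath_treePath hG r v) (isPath_treePath hG r u) huv.symm hu
    have hc := hG.isAcyclic.path_concat (isPath_treePath hG r u) (isPath_treePath hG r v) huv hu
    refine ⟨fun h => hv (Walk.snd_mem_support_of_mem_edges _ (mem_rootEdges.1 h)), fun e => ?_⟩
    rw [mem_rootEdges, mem_rootEdges, hc, Walk.edges_concat]
    simp [or_comm]
  by_cases hu : u ∈ (treePath hG r v).support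
  · exact Or.inl (key huv hu)
  · right
    rw [Sym2.eq_swap]
    exact key huv.symm (hG.isAcyclic.mem_support_of_ne_mem_support_of_adj_of_isPath
      (isPath_treePath hG r u) (isPath_treePath hG r v) huv hu)

/-- The edges of a trail are those that separate exactly one of its ends from the root. -/
theorem mem_edges_iff_rootEdges (hG : G.IsTree) (r : V) {u v : V} {p : G.Walk u v}
    (hp : p.IsTrail) (e : Sym2 V) :
    e ∈ p.edges ↔ ¬(e ∈ rootEdges hG r u ↔ e ∈ rootEdges hG r v) := by
  induction p with
  | nil => simp
  | @cons u w v huw p ih =>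
    rw [Walk.isTrail_cons] at hp
    have ih := ih hp.1
    rw [Walk.edges_cons, List.mem_cons]
    by_cases he : e = s(u, w)
    · subst he
      have hne := hp.2
      rcases rootEdges_of_adj hG r huw with ⟨h1, h2⟩ | ⟨h1, h2⟩
      · have := h2 s(u, w); tauto
      · have := h2 s(u, w); tauto
    · rcases rootEdges_of_adj hG r huw with ⟨h1, h2⟩ | ⟨h1, h2⟩
      · have := h2 e; tauto
      · have := h2 e; tauto

theorem rootEdges_subset_of_mem_support (hG : G.IsTree) {r b j : V}
    (hb : b ∈ (treePath hG r j).support) : rootEdges hG r b ⊆ rootEdges hG r j := by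
  classical
  intro e he
  rw [mem_rootEdges, ← eq_treePath hG ((isPath_treePath hG r j).takeUntil hb)] at he
  exact mem_rootEdges.2 (Walk.edges_takeUntil_subset_edges _ hb he)

theorem rootEdges_total_of_mem_support (hG : G.IsTree) {r b c j : V}
    (hb : b ∈ (treePath hG r j).support) (hc : c ∈ (treePath hG r j).support) :
    rootEdges hG r b ⊆ rootEdges hG r c ∨ rootEdges hG r c ⊆ rootEdges hG r b := by
  classical
  set p := treePath hG r j with hp
  have hpath : p.IsPath := isPath_treePath hG r j
  by_cases h : b ∈ (p.takeUntil c hc).support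
  · left
    rw [eq_treePath hG (hpath.takeUntil hc)] at h
    exact rootEdges_subset_of_mem_support hG h
  · right
    have hb' := hb
    rw [← p.take_spec hc, Walk.mem_support_append_iff] at hb'
    have hd := hb'.resolve_left h
    have hq : ((p.takeUntil c hc).append ((p.dropUntil c hc).takeUntil b hd)).IsPath := by
      have h1 : ((p.takeUntil c hc).append ((p.dropUntil c hc).takeUntil b hd)).append
          ((p.dropUntil c hc).dropUntil b hd) = p := by
        rw [← Walk.append_assoc, Walk.take_spec, Walk.take_spec]
      exact Walk.IsPath.of_append_left (h1.symm ▸ hpath)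
    refine rootEdges_subset_of_mem_support hG ?_
    rw [← eq_treePath hG hq, Walk.mem_support_append_iff]
    exact Or.inl (Walk.end_mem_support _)

/-- An edge on the path to `j` has a lower end on this path, and every path that uses the edge
passes through this end. -/
theorem exists_lower_end (hG : G.IsTree) {r j : V} {e : Sym2 V} (he : e ∈ rootEdges hG r j) :
    ∃ b ∈ (treePath hG r j).support, e ∈ rootEdges hG r b ∧
      ∀ k, e ∈ rootEdges hG r k → rootEdges hG r b ⊆ rootEdges hG r k := by
  induction e with
  | h u v =>
    have huv : G.Adj u v := Walk.adj_of_mem_edges _ (mem_rootEdges.1 he)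
    rcases rootEdges_of_adj hG r huv with ⟨-, h⟩ | ⟨-, h⟩
    · exact ⟨v, Walk.snd_mem_support_of_mem_edges _ (mem_rootEdges.1 he),
        (h _).2 (Or.inl rfl), fun k hk => rootEdges_subset_of_mem_support hG
          (Walk.snd_mem_support_of_mem_edges _ (mem_rootEdges.1 hk))⟩
    · exact ⟨u, Walk.fst_mem_support_of_mem_edges _ (mem_rootEdges.1 he),
        (h _).2 (Or.inl rfl), fun k hk => rootEdges_subset_of_mem_support hG
          (Walk.fst_mem_support_of_mem_edges _ (mem_rootEdges.1 hk))⟩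

/-- The parts that the paths to `i` and to `k` share with the path to `j` are both initial
segments of the latter, hence nested. -/
theorem rootEdges_nested (hG : G.IsTree) (r i j k : V) :
    (∀ e ∈ rootEdges hG r i, e ∈ rootEdges hG r j → e ∈ rootEdges hG r k) ∨
    (∀ e ∈ rootEdges hG r k, e ∈ rootEdges hG r j → e ∈ rootEdges hG r i) := by
  by_contra! hcon
  obtain ⟨⟨e, hei, hej, hek⟩, ⟨f, hfk, hfj, hfi⟩⟩ := hcon
  obtain ⟨b, hb, heb, hbmin⟩ := exists_lower_end hG hej
  obtain ⟨c, hc, hfc, hcmin⟩ := exists_lower_end hG hfj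
  rcases rootEdges_total_of_mem_support hG hb hc with h | h
  · exact hek (hcmin k hfk (h heb))
  · exact hfi (hbmin i hei (h hfc))

theorem IsLeaf.edge_unique {v : V} (hv : IsLeaf G v) {e f : Sym2 V} (he : e ∈ G.edgeSet)
    (hf : f ∈ G.edgeSet) (hve : v ∈ e) (hvf : v ∈ f) : e = f := by
  obtain ⟨a, rfl⟩ := hve
  obtain ⟨b, rfl⟩ := hvf
  have hab : a = b := hv.unique he hf
  rw [hab]

/-- A trail uses the edge at a leaf exactly if it is nontrivial and the leaf is one of its
ends. -/
theorem IsLeaf.mem_edges_iff {v : V} (hv : IsLeaf G v) {u w : V} {p : G.Walk u w}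
    (hp : p.IsTrail) {e : Sym2 V} (he : e ∈ G.edgeSet) (hve : v ∈ e) :
    e ∈ p.edges ↔ u ≠ w ∧ (v = u ∨ v = w) := by
  classical
  have hcount : (p.edges.countP fun e => v ∈ e) = p.edges.count e := by
    rw [List.count]
    refine List.countP_congr fun f hf => ?_
    have hf' := p.edges_subset_edgeSet hf
    simp only [decide_eq_true_eq, beq_iff_eq]
    exact ⟨fun h => hv.edge_unique hf' he h hve, fun h => h ▸ hve⟩
  have heven := hp.even_countP_edges_iff v
  rw [hcount] at heven
  by_cases hmem : e ∈ p.edges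
  · rw [List.count_eq_one_of_mem hp.edges_nodup hmem] at heven
    have : ¬ Even 1 := by decide
    tauto
  · rw [List.count_eq_zero_of_not_mem hmem] at heven
    have : Even 0 := by decide
    tauto

end RootedTree

/-! ### The ultrametric of a weighted tree -/

open Classical in
theorem WeightedTree.dist_eq {n : ℕ} (T : WeightedTree n) (r : T.V) (i j : Fin n) :
    T.dist i j = ∑ e ∈ rootEdges T.isTree r (T.leaf i), T.length e
      + ∑ e ∈ rootEdges T.isTree r (T.leaf j), T.length e
      - 2 * ∑ e ∈ rootEdges T.isTree r (T.leaf i) ∩ rootEdges T.isTree r (T.leaf j),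
        T.length e := by
  have htrail : (T.path (T.leaf i) (T.leaf j)).IsTrail :=
    (isPath_treePath T.isTree _ _).isTrail
  set A := rootEdges T.isTree r (T.leaf i)
  set B := rootEdges T.isTree r (T.leaf j)
  have hset : (T.path (T.leaf i) (T.leaf j)).edges.toFinset = (A \ (A ∩ B)) ∪ (B \ (A ∩ B)) := by
    ext e
    have := mem_edges_iff_rootEdges T.isTree r htrail e
    simp only [List.mem_toFinset, Finset.mem_union, Finset.mem_sdiff, Finset.mem_inter]
    tauto
  have hdisj : Disjoint (A \ (A ∩ B)) (B \ (A ∩ B)) := by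
    rw [Finset.disjoint_left]
    intro e
    simp only [Finset.mem_sdiff, Finset.mem_inter]
    tauto
  have hA := Finset.sum_sdiff (f := T.length) (Finset.inter_subset_left (s₁ := A) (s₂ := B))
  have hB := Finset.sum_sdiff (f := T.length) (Finset.inter_subset_right (s₁ := A) (s₂ := B))
  rw [WeightedTree.dist, ← List.sum_toFinset _ htrail.edges_nodup, hset,
    Finset.sum_union hdisj]
  linarith

/-- An edge on the paths from the leaf `r` to two other leaves `i` and `k`, but not on the path to
a third one, is an interior edge. -/
theorem WeightedTree.length_nonneg_of_mem {n : ℕ} (T : WeightedTree n) {r i j k : Fin n}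
    (hj : j ≠ r) (hik : i ≠ k) {e : Sym2 T.V}
    (hei : e ∈ rootEdges T.isTree (T.leaf r : T.V) (T.leaf i))
    (hek : e ∈ rootEdges T.isTree (T.leaf r : T.V) (T.leaf k))
    (hej : e ∉ rootEdges T.isTree (T.leaf r : T.V) (T.leaf j)) : 0 ≤ T.length e := by
  have hinj : ∀ {a b : Fin n}, (T.leaf a : T.V) = T.leaf b → a = b := fun h =>
    T.leaf.injective (Subtype.ext h)
  have htrail := fun a => (isPath_treePath T.isTree (T.leaf r : T.V) (T.leaf a)).isTrail
  have hedge : e ∈ T.graph.edgeSet := SimpleGraph.Walk.edges_subset_edgeSet _ (mem_rootEdges.1 hei)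
  have hleaf : ∀ v ∈ e, ¬ IsLeaf T.graph v := by
    intro v hve hv
    have hi := (hv.mem_edges_iff (htrail i) hedge hve).1 (mem_rootEdges.1 hei)
    have hk := (hv.mem_edges_iff (htrail k) hedge hve).1 (mem_rootEdges.1 hek)
    have hr : v = T.leaf r := by
      rcases hi.2 with h | h
      · exact h
      · rcases hk.2 with h' | h'
        · exact h'
        · exact absurd (hinj (h.symm.trans h')) hik
    exact hej (mem_rootEdges.2 ((hv.mem_edges_iff (htrail j) hedge hve).2
      ⟨fun h => hj (hinj h).symm, Or.inl hr⟩))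
  induction e with
  | h u v =>
    exact T.length_nonneg u v hedge (hleaf u (Sym2.mem_mk_left u v))
      (hleaf v (Sym2.mem_mk_right u v))

/-- The Farris transform with respect to a leaf `r`: if the edge lengths are rational, the
distances between leaves are those of an ultrametric up to leaf weights. The leaf `r` is placed at
a large distance from all the others. -/
theorem WeightedTree.exists_ultrametric {n : ℕ} (T : WeightedTree n) (r : Fin n)
    (q : Sym2 T.V → ℚ) (hq : ∀ e, T.length e = q e) :
    ∃ (h : Fin n → Fin n → ℚ) (s : Fin n → ℚ), IsOffDiagUltrametric h ∧
      ∀ i j, i ≠ j → T.dist i j = ((2 * h i j + s i + s j : ℚ) : ℝ) := by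
  classical
  set E : Fin n → Finset (Sym2 T.V) := fun i => rootEdges T.isTree (T.leaf r : T.V) (T.leaf i)
    with hE
  have hEr : E r = ∅ := rootEdges_self T.isTree _
  set g : Fin n → Fin n → ℚ := fun i j => ∑ e ∈ E i ∩ E j, q e with hg
  have hgsymm : ∀ i j, g i j = g j i := fun i j => by simp only [hg, Finset.inter_comm]
  have hdist : ∀ i j, T.dist i j = ((∑ e ∈ E i, q e + ∑ e ∈ E j, q e - 2 * g i j : ℚ) : ℝ) := by
    intro i j
    rw [T.dist_eq (T.leaf r : T.V) i j]
    simp only [hq, hE, hg]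
    push_cast
    ring
  have hle : ∀ i j k, j ≠ r → i ≠ k → (∀ e ∈ E i, e ∈ E j → e ∈ E k) → g i j ≤ g i k := by
    intro i j k hj hik hsub
    refine Finset.sum_le_sum_of_subset_of_nonneg (fun e he => ?_) fun e he hne => ?_
    · rw [Finset.mem_inter] at he ⊢
      exact ⟨he.1, hsub e he.1 he.2⟩
    · rw [Finset.mem_inter] at he hne
      have := T.length_nonneg_of_mem hj hik he.1 he.2 fun h => hne ⟨he.1, h⟩
      rw [hq] at this
      exact_mod_cast this
  obtain ⟨C, hC⟩ : ∃ C : ℚ, ∀ i j, -g i j ≤ C := by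
    obtain ⟨C, hC⟩ := (Set.finite_range fun p : Fin n × Fin n => -g p.1 p.2).bddAbove
    exact ⟨C, fun i j => hC ⟨(i, j), rfl⟩⟩
  -- The bound `C` keeps the ultrametric inequality when `r` is put at distance `C` from all other
  -- leaves; the weight `-2 * C` of `r` compensates for it in `2 * h i r + s i + s r`.
  refine ⟨fun i j => if i = r ∨ j = r then C else -g i j,
    fun i => if i = r then -2 * C else ∑ e ∈ E i, q e, ⟨fun i j => ?_, fun i j k hij hjk hik => ?_⟩,
    fun i j hij => ?_⟩
  · simp only [or_comm, hgsymm i j]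
  · by_cases hi : i = r
    · simp [hi]
    by_cases hk : k = r
    · simp [hk]
    by_cases hj : j = r
    · simp [hj, hi, hk, hC]
    · simp only [hi, hj, hk, or_self, if_false, le_max_iff, neg_le_neg_iff]
      rcases rootEdges_nested T.isTree (T.leaf r : T.V) (T.leaf i) (T.leaf j) (T.leaf k)
        with h | h
      · exact Or.inl (hle i j k hj hik h)
      · right
        rw [hgsymm j k, hgsymm i k]
        exact hle k j i hj hik.symm h
  · rw [hdist i j]
    congr 1
    by_cases hi : i = r
    · have hj : j ≠ r := fun h => hij (hi.trans h.symm)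
      simp [hi, hj, hg, hEr]
    · by_cases hj : j = r
      · simp [hi, hj, hg, hEr]
      · simp [hi, hj]; ring

/-! ### Rational approximation -/

theorem phi4_apply {n : ℕ} (X : IncreasingPair n → ℝ) (D : Fin n → Fin n → ℝ)
    (hD : ∀ p : IncreasingPair n, X p = D p.1.1 p.1.2) (e : Fin 4 ↪o Fin n) :
    phi4 n X e = minTour D (e 0) (e 1) (e 2) (e 3) / 2 := by
  simp only [phi4, minTour, hD]

/-- A tour meets every one of the four points twice, so leaf weights contribute their sum. -/
theorem minTour_two_mul_add {ι : Type} {D : ι → ι → ℝ} {h : ι → ι → ℚ} {s : ι → ℚ}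
    (hD : ∀ i j, i ≠ j → D i j = ((2 * h i j + s i + s j : ℚ) : ℝ)) (e : Fin 4 ↪ ι) :
    minTour D (e 0) (e 1) (e 2) (e 3) / 2 = ((minTour h (e 0) (e 1) (e 2) (e 3)
      + (s (e 0) + s (e 1) + s (e 2) + s (e 3)) : ℚ) : ℝ) := by
  have hne : ∀ {a b : Fin 4}, a ≠ b → e a ≠ e b := fun h => e.injective.ne h
  unfold minTour
  rw [hD _ _ (hne (a := 0) (b := 1) (by decide)), hD _ _ (hne (a := 0) (b := 2) (by decide)),
    hD _ _ (hne (a := 0) (b := 3) (by decide)), hD _ _ (hne (a := 1) (b := 2) (by decide)),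
    hD _ _ (hne (a := 1) (b := 3) (by decide)), hD _ _ (hne (a := 2) (b := 3) (by decide))]
  push_cast
  rw [← min_add_add_right, ← min_add_add_right, ← min_div_div_right (by norm_num : (0 : ℝ) ≤ 2),
    ← min_div_div_right (by norm_num : (0 : ℝ) ≤ 2)]
  exact congrArg₂ min (by ring) (congrArg₂ min (by ring) (by ring))

theorem WeightedTree.phi4_mem_of_rational {n : ℕ} (T : WeightedTree n) (q : Sym2 T.V → ℚ)
    (hq : ∀ e, T.length e = q e) :
    phi4 n T.dissimilarityVector ∈ tropicalGrassmannian 4 n := by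
  have main : ∀ (h : Fin n → Fin n → ℚ) (s : Fin n → ℚ), IsOffDiagUltrametric h →
      (∀ i j, i ≠ j → T.dist i j = ((2 * h i j + s i + s j : ℚ) : ℝ)) →
      phi4 n T.dissimilarityVector ∈ tropicalGrassmannian 4 n := by
    intro h s hh hD
    convert minTour_add_mem_tropicalGrassmannian hh s using 1
    ext e
    rw [phi4_apply T.dissimilarityVector T.dist (fun _ => rfl) e]
    exact minTour_two_mul_add hD e.toEmbedding
  rcases isEmpty_or_nonempty (Fin n) with hn | ⟨⟨r⟩⟩
  · exact main (fun i => hn.elim i) (fun i => hn.elim i)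
      ⟨fun i => hn.elim i, fun i => hn.elim i⟩ fun i => hn.elim i
  · obtain ⟨h, s, hh, hD⟩ := T.exists_ultrametric r q hq
    exact main h s hh hD

theorem continuous_phi4 (n : ℕ) : Continuous (phi4 n) := by
  refine continuous_pi fun e => ?_
  simp only [phi4]
  fun_prop

/-- The tree with the same graph and other edge lengths. -/
def WeightedTree.withLength {n : ℕ} (T : WeightedTree n) (f : Sym2 T.V → ℝ)
    (hf : ∀ e, 0 ≤ T.length e → 0 ≤ f e) : WeightedTree n where
  V := T.V
  finite := T.finite
  graph := T.graph
  isTree := T.isTree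
  leaf := T.leaf
  length := f
  length_nonneg u v huv hu hv := hf _ (T.length_nonneg u v huv hu hv)

theorem WeightedTree.phi4_mem {n : ℕ} (T : WeightedTree n) :
    phi4 n T.dissimilarityVector ∈ tropicalGrassmannian 4 n := by
  have hex : ∀ (k : ℕ) (e : Sym2 T.V), ∃ q : ℚ, T.length e < q ∧
      (q : ℝ) < T.length e + 1 / ((k : ℝ) + 1) := fun k e =>
    exists_rat_btwn (lt_add_of_pos_right _ Nat.one_div_pos_of_nat)
  choose q hq1 hq2 using hex
  have hlim : ∀ e, Filter.Tendsto (fun k => ((q k e : ℚ) : ℝ)) Filter.atTop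
      (nhds (T.length e)) := by
    intro e
    refine tendsto_of_tendsto_of_tendsto_of_le_of_le tendsto_const_nhds ?_
      (fun k => (hq1 k e).le) (fun k => (hq2 k e).le)
    simpa using tendsto_const_nhds.add (tendsto_one_div_add_atTop_nhds_zero_nat (𝕜 := ℝ))
  let T' : ℕ → WeightedTree n := fun k =>
    T.withLength (fun e => q k e) fun e he => he.trans (hq1 k e).le
  have hsum : ∀ l : List (Sym2 T.V), Filter.Tendsto
      (fun k => (l.map fun e => ((q k e : ℚ) : ℝ)).sum) Filter.atTop
      (nhds (l.map T.length).sum) := by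
    intro l
    induction l with
    | nil => simp
    | cons e l ih => simpa using (hlim e).add ih
  have hD : Filter.Tendsto (fun k => (T' k).dissimilarityVector) Filter.atTop
      (nhds T.dissimilarityVector) :=
    tendsto_pi_nhds.2 fun p => hsum (T.path (T.leaf p.1.1) (T.leaf p.1.2)).edges
  have hclosed : IsClosed (tropicalGrassmannian 4 n) := isClosed_closure
  exact hclosed.mem_of_tendsto (((continuous_phi4 n).tendsto _).comp hD)
    (Filter.Eventually.of_forall fun k => (T' k).phi4_mem_of_rational (q k) fun _ => rfl)

end

theorem mainTheorem1 (n : ℕ) :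
    phi4 n '' treeSpace n ⊆ tropicalGrassmannian 4 n ∩ Set.range (phi4 n) := by
  rintro _ ⟨_, ⟨T, rfl⟩, rfl⟩
  exact ⟨T.phi4_mem, _, rfl⟩
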